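/- **Setting.** A Mealy automaton $\mathcal A=(Q,\Sigma,\delta,\rho)$ consists of finite sets $Q$ (states) and $\Sigma$ (letters) and functions $\delta_i\colon Q\to Q$ $(i\in\Sigma)$ and $\rho_x\colon\Sigma\to\Sigma$ $(x\in Q)$. Each $\rho_x$ extends to $\Sigma^*$ by $\rho_x(i\mathbf s)=\rho_x(i)\,\rho_{\delta_i(x)}(\mathbf s)$, and dually each $\delta_i$ extends to $Q^*$ by $\delta_i(x\mathbf u)=\delta_i(x)\,\delta_{\rho_x(i)}(\mathbf u)$; for $\mathbf u=x_1\cdots x_k\in Q^*$ put $\rho_{\mathbf u}=\rho_{x_k}\circ\cdots\circ\rho_{x_1}$. The automaton is *bireversible* if all $\rho_x$ and all $\delta_i$ are permutations and, for every $j\in\Sigma$, the map $x\mapsto\delta_{\rho_x^{-1}(j)}(x)$ is a permutation of $Q$; it is *connected* if the graph on $Q$ with edges $x\to\delta_i(x)$ is connected. The connected components of $Q^k$ are those of the graph with edges $\mathbf u\to\delta_i(\mathbf u)$. The *orbit tree* of $\mathcal A$ has as vertices of level $k\ge 0$ the connected components of $Q^k$, with an edge from the component of $\mathbf u$ to that of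 $\mathbf ux$ for all $\mathbf u\in Q^*$, $x\in Q$. For an edge $e\colon C\to D$ write $\top(e)=C$, $\bot(e)=D$; its *label* is $\#D/\#C$. An edge $f$ is a *child* of $e$ if $\top(f)=\bot(e)$. An edge $e$ is *liftable* to an edge $f$ if every word of $\bot(e)$ has a word of $\bot(f)$ as a suffix. A *legitimate child* of $e$ is a child of $e$ that is liftable to $e$. A path $(e_i)_i$ starting at the root is $k$-*self-liftable* if $e_{i+k}$ is liftable to $e_i$ for all $i$ for which both edges exist, and *self-liftable* if this holds for some $k>0$. An infinite path starting at the root (a branch) is *active* if its labels are not ultimately all equal to $1$. Assume that $\mathcal A$ is connected and bireversible and that its orbit tree has no active self-liftable branch. Let $\mathbf e$ be a $1$-self-liftable path starting at the root, of finite length $n\ge1$, whose last edge $e_{\mathrm{last}}$ has at least two legitimate children, all of them of label $1$. The *jungle tree* $\mathfrak j$ of $\mathbf e$ is the subtree of the orbit tree consisting of the edges of $\mathbf e$ and of the tree rooted at $\bot(e_{\mathrm{last}})$ formed by its descending edges that are liftable to $e_{\mathrm{last}}$. A *$\mathfrak j$-word* is a word $\mathbf w\in Q^*$ such that the path through the components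 of the successive prefixes of $\mathbf w$ lies in $\mathfrak j$. A *stem* is a word in the component $\bot(e_{\mathrm{last}})\subseteq Q^n$. For stems $\mathbf u,\mathbf v$ write $\mathbf u\sim\mathbf v$ if there is $\mathbf s\in Q^*$ such that $\mathbf{usv}$ is a $\mathfrak j$-word and $\rho_{\mathbf{us}}$ is the identity on $\Sigma^*$. Write $\mathbf u\wedge_0\mathbf v$ if there is a stem $\mathbf s$ such that $\mathbf{su}$ and $\mathbf{sv}$ are both $\mathfrak j$-words, and let $\wedge$ be the transitive closure of $\wedge_0$. **Statement.** The relation $\sim$ is an equivalence relation on the set of stems. The relation $\wedge$ is an equivalence relation on the set of stems, and it is finer than $\sim$: $\mathbf u\wedge\mathbf v$ implies $\mathbf u\sim\mathbf v$. -/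

import Mathlib

/-- A Mealy automaton with stateset `Q` and alphabet `X`: `δ i x` is the target and `ρ x i` the
output letter of the transition that starts in the state `x` and reads the letter `i`. -/
structure MealyAut (Q X : Type*) where
  δ : X → Q → Q
  ρ : Q → X → X

namespace MealyAut

variable {Q X : Type*}

/-- The dual automaton, in which states and letters exchange their roles. -/
def dual (A : MealyAut Q X) : MealyAut X Q where
  δ := A.ρ
  ρ := A.δ

def Invertible (A : MealyAut Q X) : Prop := ∀ x, Function.Bijective (A.ρ x)

def Reversible (A : MealyAut Q X) : Prop := ∀ i, Function.Bijective (A.δ i)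

/-- Invertible, reversible, and each output letter `j` permutes the stateset: every state `y` is the
target of a transition with output `j` from exactly one state `x`. -/
def Bireversible (A : MealyAut Q X) : Prop :=
  A.Invertible ∧ A.Reversible ∧ ∀ (j : X) (y : Q), ∃! x : Q, ∃ i : X, A.ρ x i = j ∧ A.δ i x = y

/-- The underlying graph of the automaton is connected. -/
def Connected (A : MealyAut Q X) : Prop :=
  ∀ x y : Q, Relation.EqvGen (fun a b => ∃ i, A.δ i a = b) x y

/-- The function `ρ_x` on words induced by a state:
`ρ_x (i s) = ρ_x(i) ρ_{δ_i(x)}(s)`. -/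
def act (A : MealyAut Q X) : Q → List X → List X
  | _, [] => []
  | x, i :: s => A.ρ x i :: A.act (A.δ i x) s

/-- The function `ρ_u = ρ_{x_n} ∘ ⋯ ∘ ρ_{x_1}` induced by a word `u = x_1 ⋯ x_n` of states. -/
def actWord (A : MealyAut Q X) (u : List Q) (s : List X) : List X :=
  u.foldl (fun t x => A.act x t) s

/-- Two words of states lie in the same connected component of a power of `A`. The transition of
`A ^ n` with input letter `i` is the function `δ_i` on `Q ^ n` induced by the state `i` of the dual
automaton. It preserves the length, so all powers are treated at once. -/
def connSetoid (A : MealyAut Q X) : Setoid (List Q) :=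
  Relation.EqvGen.setoid (fun u v => ∃ i, A.dual.act i u = v)

/-- Vertices of the orbit tree: the connected components of the powers of `A`. -/
abbrev Vertex (A : MealyAut Q X) := Quotient A.connSetoid

/-- The connected component of a word. -/
def vertexOf (A : MealyAut Q X) (u : List Q) : A.Vertex := Quotient.mk A.connSetoid u

/-- The words in a connected component. -/
def words (A : MealyAut Q X) (C : A.Vertex) : Set (List Q) := {u | A.vertexOf u = C}

/-- The root of the orbit tree: the only component of the trivial automaton `A ^ 0`. -/
def root (A : MealyAut Q X) : A.Vertex := A.vertexOf []

/-- Edges of the orbit tree: the component of `u` is linked to the component of `u x`. -/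
@[ext]
structure Edge (A : MealyAut Q X) where
  top : A.Vertex
  bot : A.Vertex
  adj : ∃ (u : List Q) (x : Q), A.vertexOf u = top ∧ A.vertexOf (u ++ [x]) = bot

/-- The edge from the component of `u` to that of `u x`. -/
def edgeOf (A : MealyAut Q X) (u : List Q) (x : Q) : A.Edge :=
  ⟨A.vertexOf u, A.vertexOf (u ++ [x]), u, x, rfl, rfl⟩

namespace Edge

variable {A : MealyAut Q X}

/-- The label of an edge: the ratio of the sizes of its two end components. -/
noncomputable def label (e : A.Edge) : ℚ :=
  ((A.words e.bot).ncard : ℚ) / ((A.words e.top).ncard : ℚ)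

/-- `e` is liftable to `f`: each word of `⊥(e)` has some word of `⊥(f)` as a suffix. -/
def Liftable (e f : A.Edge) : Prop :=
  ∀ w ∈ A.words e.bot, ∃ v ∈ A.words f.bot, v <:+ w

/-- `f.IsChild e`: the edge `f` starts where the edge `e` ends. -/
def IsChild (f e : A.Edge) : Prop := e.bot = f.top

/-- `f.IsLegitimateChild e`: `f` is a child of `e` and is liftable to `e`. -/
def IsLegitimateChild (f e : A.Edge) : Prop := f.IsChild e ∧ f.Liftable e

end Edge

/-- A branch: an infinite path that starts at the root, given by its edges. -/
def IsBranch (A : MealyAut Q X) (b : ℕ → A.Edge) : Prop :=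
  (b 0).top = A.root ∧ ∀ i, (b (i + 1)).IsChild (b i)

/-- A branch is self-liftable if for some `k > 0` each of its paths that starts at level `i + k` is
liftable, edge by edge, to the path of the same length that starts at level `i`. -/
def IsSelfLiftableBranch (A : MealyAut Q X) (b : ℕ → A.Edge) : Prop :=
  A.IsBranch b ∧ ∃ k, 0 < k ∧ ∀ i, (b (i + k)).Liftable (b i)

/-- A branch is active if its sequence of labels does not end in `1 1 1 ⋯`. -/
def IsActive (A : MealyAut Q X) (b : ℕ → A.Edge) : Prop :=
  ¬ ∃ N, ∀ i, N ≤ i → (b i).label = 1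

/-- The orbit tree has no active self-liftable branch. -/
def NoActiveSelfLiftableBranch (A : MealyAut Q X) : Prop :=
  ¬ ∃ b : ℕ → A.Edge, A.IsSelfLiftableBranch b ∧ A.IsActive b

/-- `e` is the trunk of a jungle tree: a finite initial path with `m + 1 ≥ 1` edges that is
1-self-liftable, whose last edge has at least two legitimate children, all of label 1. -/
structure IsTrunk (A : MealyAut Q X) {m : ℕ} (e : Fin (m + 1) → A.Edge) : Prop where
  initial : (e 0).top = A.root
  path : ∀ i : Fin m, (e i.succ).IsChild (e i.castSucc)
  selfLiftable : ∀ i : Fin m, (e i.succ).Liftable (e i.castSucc)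
  two_children : {f : A.Edge | f.IsLegitimateChild (e (Fin.last m))}.Nontrivial
  label_children : ∀ f : A.Edge, f.IsLegitimateChild (e (Fin.last m)) → f.label = 1

/-- The edges of the jungle tree of `e`: the edges of the trunk `e`, and the tree rooted at the end
of the trunk formed by its descending edges that are liftable to the last edge of `e` (as it is a
tree, an edge belongs to it only together with the edges that link it to the end of the trunk). -/
def jungleTree (A : MealyAut Q X) {m : ℕ} (e : Fin (m + 1) → A.Edge) : Set A.Edge :=
  Set.range e ∪
    {f | Relation.ReflTransGen
      (fun g h : A.Edge => h.IsChild g ∧ h.Liftable (e (Fin.last m))) (e (Fin.last m)) f}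

/-- `w` is a (finite) `𝔰`-word for the subtree with set of edges `𝔰`: the path of `w`, which goes
from the root through the components of the prefixes of `w`, stays in `𝔰`. -/
def IsTreeWord (A : MealyAut Q X) (𝔰 : Set A.Edge) (w : List Q) : Prop :=
  ∀ (u : List Q) (x : Q), u ++ [x] <+: w → A.edgeOf u x ∈ 𝔰

/-- The stems: the words in the component at the end of the trunk. -/
abbrev Stem (A : MealyAut Q X) {m : ℕ} (e : Fin (m + 1) → A.Edge) :=
  {u : List Q // u ∈ A.words (e (Fin.last m)).bot}

/-- The relation `∼` on stems: for some word `s`, `u s v` is a word of the jungle tree and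
`ρ_{us}` is the identity. -/
def StemEquiv (A : MealyAut Q X) {m : ℕ} (e : Fin (m + 1) → A.Edge) (u v : A.Stem e) : Prop :=
  ∃ s : List Q, A.IsTreeWord (A.jungleTree e) (u.1 ++ s ++ v.1) ∧
    ∀ t : List X, A.actWord (u.1 ++ s) t = t

/-- The relation `∧₀` on stems: for some stem `s`, both `s u` and `s v` are words of the jungle
tree. -/
def Sibling (A : MealyAut Q X) {m : ℕ} (e : Fin (m + 1) → A.Edge) (u v : A.Stem e) : Prop :=
  ∃ s : A.Stem e, A.IsTreeWord (A.jungleTree e) (s.1 ++ u.1) ∧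
    A.IsTreeWord (A.jungleTree e) (s.1 ++ v.1)

/-- The relation `∧` on stems: the transitive closure of `∧₀`. -/
def Wedge (A : MealyAut Q X) {m : ℕ} (e : Fin (m + 1) → A.Edge) : A.Stem e → A.Stem e → Prop :=
  Relation.TransGen (A.Sibling e)

end MealyAut

/-! Beyond the trunk, the jungle tree is described locally: a word of length at least `m + 1` is a
jungle word exactly when all its factors of length `m + 1` are stems (`isTreeWord_iff`). Hence
jungle words that overlap in a stem can be glued (`FactorStems.glue`), and being a jungle word
depends only on the component.

Two finiteness arguments then produce cycles with trivial action.

Rigidity: since the legitimate children of the last trunk edge have label 1, a long jungle word is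
determined by its component and its first stem (`IsTrunk.eq_of_conn_of_take_eq`). The component of a
power of `w` is thus an automaton whose states are named by stems, with transitions that do not
depend on the exponent. Only finitely many output functions are possible, so if all powers of `w`
are jungle words, two of them act alike, and by invertibility some power acts trivially
(`IsTrunk.exists_pow_actWord_eq`).

Recurrence: appending the letters prescribed by one legitimate child and dropping the first letters
permutes the finite set of stems, by bireversibility. Each step is undone by iterating this
permutation, so reachability between stems is symmetric (`IsTrunk.reaches_symm`), every path closes
up, and every closed path extends to a trivial cycle (`IsTrunk.exists_trivial_cycle`).

Reflexivity of `∼` is such a cycle; symmetry closes a trivial path `u s` and cancels it;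
transitivity is gluing. If `s u` and `s v` are jungle words, a trivial cycle through `s u` is
rotated to start at `u` and end with `s`, after which `v` may follow. -/

namespace MealyAut

variable {Q X : Type*}

/-- Two words of states lie in the same connected component. -/
def Conn (A : MealyAut Q X) (u v : List Q) : Prop :=
  Relation.EqvGen (fun u v => ∃ i, A.dual.act i u = v) u v

/-- The letter output by the word `u` of states on the input letter `i`. -/
def outLetter (A : MealyAut Q X) (u : List Q) (i : X) : X :=
  u.foldl (fun j x => A.ρ x j) i

/-! ### Action of words of states on letters and on words -/

section Action

variable (A : MealyAut Q X)

theorem length_act (x : Q) (s : List X) : (A.act x s).length = s.length := by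
  induction s generalizing x with
  | nil => rfl
  | cons i s ih => simp [act, ih]

theorem act_append (i : X) (u v : List Q) :
    A.dual.act i (u ++ v) = A.dual.act i u ++ A.dual.act (A.outLetter u i) v := by
  induction u generalizing i with
  | nil => rfl
  | cons x u ih =>
    rw [List.cons_append, act, act, ih, List.cons_append]
    rfl

theorem take_act (k : ℕ) (i : X) (u : List Q) :
    (A.dual.act i u).take k = A.dual.act i (u.take k) := by
  conv_lhs => rw [← List.take_append_drop k u, act_append]
  by_cases h : k ≤ u.length
  · rw [List.take_left' (by rw [length_act, List.length_take, min_eq_left h])]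
  · have h' : u.length ≤ k := by omega
    rw [List.drop_eq_nil_of_le h', List.take_of_length_le (l := u) h', act, List.append_nil,
      List.take_of_length_le (by rw [length_act]; exact h')]

theorem drop_act (k : ℕ) (i : X) (u : List Q) :
    (A.dual.act i u).drop k = A.dual.act (A.outLetter (u.take k) i) (u.drop k) := by
  conv_lhs => rw [← List.take_append_drop k u, act_append]
  by_cases h : k ≤ u.length
  · rw [List.drop_left' (by rw [length_act, List.length_take, min_eq_left h])]
  · have h' : u.length ≤ k := by omega
    rw [List.drop_eq_nil_of_le h', List.take_of_length_le (l := u) h', act, List.append_nil,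
      List.drop_eq_nil_of_le (by rw [length_act]; exact h')]

theorem actWord_append (u v : List Q) (t : List X) :
    A.actWord (u ++ v) t = A.actWord v (A.actWord u t) :=
  List.foldl_append

theorem actWord_nil (u : List Q) : A.actWord u [] = [] := by
  induction u with
  | nil => rfl
  | cons x u ih => exact ih

/-- This lets an induction on the input move from `u` to another word of the same component. -/
theorem actWord_cons (u : List Q) (i : X) (t : List X) :
    A.actWord u (i :: t) = A.outLetter u i :: A.actWord (A.dual.act i u) t := by
  induction u generalizing i t with
  | nil => rfl
  | cons x u ih => exact ih (A.ρ x i) (A.act (A.δ i x) t)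

variable {A}

theorem Invertible.act_surjective (h : A.Invertible) (x : Q) : Function.Surjective (A.act x) := by
  intro t
  induction t generalizing x with
  | nil => exact ⟨[], rfl⟩
  | cons j t ih =>
    obtain ⟨i, hi⟩ := (h x).2 j
    obtain ⟨s, hs⟩ := ih (A.δ i x)
    exact ⟨i :: s, by rw [act, hi, hs]⟩

theorem Invertible.actWord_surjective (h : A.Invertible) (u : List Q) :
    Function.Surjective (A.actWord u) := by
  induction u with
  | nil => exact fun t => ⟨t, rfl⟩
  | cons x u ih => exact ih.comp (h.act_surjective x)

/-- If `ρ_u ρ_v` is the identity, so is `ρ_v ρ_u`. -/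
theorem Invertible.actWord_rotate (h : A.Invertible) {u v : List Q}
    (huv : ∀ t, A.actWord (u ++ v) t = t) (t : List X) : A.actWord (v ++ u) t = t := by
  obtain ⟨s, rfl⟩ := h.actWord_surjective u t
  rw [actWord_append, ← A.actWord_append u v, huv]

end Action

/-! ### Connected components, extensions of words, and labels -/

section Conn

variable {A : MealyAut Q X}

theorem vertexOf_eq_iff {u v : List Q} : A.vertexOf u = A.vertexOf v ↔ A.Conn u v :=
  ⟨fun h => Quotient.exact h, fun h => Quotient.sound h⟩

theorem Conn.refl (u : List Q) : A.Conn u u := Relation.EqvGen.refl u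

theorem Conn.symm {u v : List Q} (h : A.Conn u v) : A.Conn v u := Relation.EqvGen.symm _ _ h

theorem Conn.trans {u v w : List Q} (h : A.Conn u v) (h' : A.Conn v w) : A.Conn u w :=
  Relation.EqvGen.trans _ _ _ h h'

theorem conn_act (i : X) (u : List Q) : A.Conn u (A.dual.act i u) :=
  Relation.EqvGen.rel _ _ ⟨i, rfl⟩

theorem Conn.length_eq {u v : List Q} (h : A.Conn u v) : u.length = v.length := by
  induction h with
  | rel u v h => obtain ⟨i, rfl⟩ := h; exact (length_act _ _ _).symm
  | refl => rfl
  | symm _ _ _ ih => exact ih.symm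
  | trans _ _ _ _ _ ih ih' => exact ih.trans ih'

theorem Conn.take {u v : List Q} (h : A.Conn u v) (k : ℕ) : A.Conn (u.take k) (v.take k) := by
  induction h with
  | rel u v h => obtain ⟨i, rfl⟩ := h; rw [take_act]; exact conn_act _ _
  | refl => exact .refl _
  | symm _ _ _ ih => exact ih.symm
  | trans _ _ _ _ _ ih ih' => exact ih.trans ih'

/-- A letter acting on a word reaches a suffix as the letter output by the preceding prefix. -/
theorem Conn.drop {u v : List Q} (h : A.Conn u v) (k : ℕ) : A.Conn (u.drop k) (v.drop k) := by
  induction h with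
  | rel u v h => obtain ⟨i, rfl⟩ := h; rw [drop_act]; exact conn_act _ _
  | refl => exact .refl _
  | symm _ _ _ ih => exact ih.symm
  | trans _ _ _ _ _ ih ih' => exact ih.trans ih'

theorem Conn.of_concat {u v : List Q} {x y : Q} (h : A.Conn (u ++ [x]) (v ++ [y])) :
    A.Conn u v := by
  have hl : u.length = v.length := by simpa using h.length_eq
  have := h.take u.length
  rwa [List.take_left, List.take_left' hl.symm] at this

/-- A connection of words extends to a connection of one-letter extensions on the right. -/
theorem Conn.exists_concat (hrev : A.Reversible) {u v : List Q} (h : A.Conn u v) (x : Q) :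
    ∃ y, A.Conn (u ++ [x]) (v ++ [y]) := by
  -- The claim for both directions at once is stable under the symmetry of the generated
  -- equivalence.
  suffices H : (∀ x, ∃ y, A.Conn (u ++ [x]) (v ++ [y])) ∧
      ∀ y, ∃ x, A.Conn (u ++ [x]) (v ++ [y]) from H.1 x
  clear x
  induction h with
  | rel u v h =>
    obtain ⟨i, rfl⟩ := h
    have key (x : Q) : A.Conn (u ++ [x]) (A.dual.act i u ++ [A.δ (A.outLetter u i) x]) := by
      have := conn_act (A := A) i (u ++ [x])
      rwa [act_append] at this
    refine ⟨fun x => ⟨_, key x⟩, fun y => ?_⟩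
    obtain ⟨x, rfl⟩ := (hrev (A.outLetter u i)).2 y
    exact ⟨x, key x⟩
  | refl u => exact ⟨fun x => ⟨x, .refl _⟩, fun x => ⟨x, .refl _⟩⟩
  | symm _ _ _ ih =>
    exact ⟨fun x => (ih.2 x).imp fun _ h => h.symm, fun x => (ih.1 x).imp fun _ h => h.symm⟩
  | trans _ _ _ _ _ ih ih' =>
    refine ⟨fun x => ?_, fun y => ?_⟩
    · obtain ⟨y, hy⟩ := ih.1 x
      exact (ih'.1 y).imp fun _ h => hy.trans h
    · obtain ⟨x, hx⟩ := ih'.2 y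
      exact (ih.2 x).imp fun _ h => h.trans hx

/-- A connection of words extends to a connection of one-letter extensions on the left. -/
theorem Conn.exists_cons (hb : A.Bireversible) {u v : List Q} (h : A.Conn u v) (x : Q) :
    ∃ y, A.Conn (x :: u) (y :: v) := by
  suffices H : (∀ x, ∃ y, A.Conn (x :: u) (y :: v)) ∧
      ∀ y, ∃ x, A.Conn (x :: u) (y :: v) from H.1 x
  clear x
  induction h with
  | rel u v h =>
    obtain ⟨i, rfl⟩ := h
    have key (x : Q) (j : X) (hj : A.ρ x j = i) :
        A.Conn (x :: u) (A.δ j x :: A.dual.act i u) := by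
      subst hj
      exact conn_act j (x :: u)
    refine ⟨fun x => ?_, fun y => ?_⟩
    · obtain ⟨j, hj⟩ := (hb.1 x).2 i
      exact ⟨_, key x j hj⟩
    -- Here the third condition of bireversibility is needed: some transition with output `i` enters
    -- `y`.
    · obtain ⟨x, ⟨j, hj, rfl⟩, -⟩ := hb.2.2 i y
      exact ⟨x, key x j hj⟩
  | refl u => exact ⟨fun x => ⟨x, .refl _⟩, fun x => ⟨x, .refl _⟩⟩
  | symm _ _ _ ih =>
    exact ⟨fun x => (ih.2 x).imp fun _ h => h.symm, fun x => (ih.1 x).imp fun _ h => h.symm⟩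
  | trans _ _ _ _ _ ih ih' =>
    refine ⟨fun x => ?_, fun y => ?_⟩
    · obtain ⟨y, hy⟩ := ih.1 x
      exact (ih'.1 y).imp fun _ h => hy.trans h
    · obtain ⟨x, hx⟩ := ih'.2 y
      exact (ih.2 x).imp fun _ h => h.trans hx

theorem finite_words [Finite Q] (u : List Q) : (A.words (A.vertexOf u)).Finite :=
  (List.finite_length_eq Q u.length).subset fun _ h => (vertexOf_eq_iff.1 h).length_eq

/-- Below an edge of label `1`, a word has only one extension. -/
theorem concat_unique_of_label_eq_one [Finite Q] (hrev : A.Reversible) {p : List Q} {x y : Q}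
    (hl : (A.edgeOf p x).label = 1) (h : A.Conn (p ++ [x]) (p ++ [y])) : x = y := by
  have hcard : (A.words (A.vertexOf (p ++ [x]))).ncard = (A.words (A.vertexOf p)).ncard := by
    -- A zero denominator would make the label `0` by the convention for division, not `1`.
    have h0 : ((A.words (A.vertexOf p)).ncard : ℚ) ≠ 0 := by
      intro h0
      rw [Edge.label] at hl
      change _ / ((A.words (A.vertexOf p)).ncard : ℚ) = 1 at hl
      rw [h0, div_zero] at hl
      exact zero_ne_one hl
    exact_mod_cast (div_eq_one_iff_eq h0).1 hl
  have himage : List.dropLast '' A.words (A.vertexOf (p ++ [x])) = A.words (A.vertexOf p) := by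
    ext w
    constructor
    · rintro ⟨w', hw', rfl⟩
      have hc : A.Conn w' (p ++ [x]) := vertexOf_eq_iff.1 hw'
      have hne : w' ≠ [] := by
        rintro rfl
        simpa using hc.length_eq
      rw [← List.dropLast_append_getLast hne] at hc
      exact vertexOf_eq_iff.2 hc.of_concat
    · intro hw
      obtain ⟨z, hz⟩ := Conn.exists_concat hrev (vertexOf_eq_iff.1 hw).symm x
      exact ⟨w ++ [z], vertexOf_eq_iff.2 hz.symm, by simp⟩
  -- Deleting the last letter maps a finite set onto one of the same cardinality, hence injectively.
  have hinj : Set.InjOn List.dropLast (A.words (A.vertexOf (p ++ [x]))) :=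
    Set.injOn_of_ncard_image_eq (by rw [himage, hcard]) (finite_words _)
  have := hinj (show p ++ [x] ∈ _ from rfl) (show p ++ [y] ∈ _ from vertexOf_eq_iff.2 h.symm)
    (by simp)
  simpa using this

end Conn

/-! ### Stems and the local description of jungle words -/

section Trunk

variable {A : MealyAut Q X} {m : ℕ} {e : Fin (m + 1) → A.Edge}

/-- A word is a stem: it lies in the component at the end of the trunk. -/
abbrev IsStem (A : MealyAut Q X) {m : ℕ} (e : Fin (m + 1) → A.Edge) (u : List Q) : Prop :=
  u ∈ A.words (e (Fin.last m)).bot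

/-- A word at least as long as the trunk whose factors of the length of the trunk are stems. -/
def FactorStems (A : MealyAut Q X) {m : ℕ} (e : Fin (m + 1) → A.Edge) (w : List Q) : Prop :=
  m + 1 ≤ w.length ∧ ∀ v, v <:+: w → v.length = m + 1 → A.IsStem e v

theorem finite_stem [Finite Q] (A : MealyAut Q X) {m : ℕ} (e : Fin (m + 1) → A.Edge) :
    Finite (A.Stem e) := by
  obtain ⟨p, x, -, hx⟩ := (e (Fin.last m)).adj
  have := finite_words (A := A) (p ++ [x])
  rw [hx] at this
  exact this.to_subtype

theorem IsStem.of_conn {u v : List Q} (hu : A.IsStem e u) (h : A.Conn u v) : A.IsStem e v :=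
  (vertexOf_eq_iff.2 h.symm).trans hu

theorem IsStem.conn {u v : List Q} (hu : A.IsStem e u) (hv : A.IsStem e v) : A.Conn u v :=
  vertexOf_eq_iff.1 (Eq.trans hu (Eq.symm hv))

theorem IsTrunk.length_of_mem_bot (he : A.IsTrunk e) (i : Fin (m + 1)) {u : List Q}
    (hu : A.vertexOf u = (e i).bot) : u.length = i + 1 := by
  induction i using Fin.induction generalizing u with
  | zero =>
    obtain ⟨p, x, hp, hx⟩ := (e 0).adj
    have h1 := (vertexOf_eq_iff.1 (hp.trans he.initial)).length_eq
    have h2 := (vertexOf_eq_iff.1 (hu.trans hx.symm)).length_eq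
    simp at h1 h2
    simp [h1, h2]
  | succ i ih =>
    obtain ⟨p, x, hp, hx⟩ := (e i.succ).adj
    have h1 := ih (hp.trans (he.path i).symm)
    have h2 := (vertexOf_eq_iff.1 (hu.trans hx.symm)).length_eq
    simp at h1 h2
    simp [h1, h2]

theorem IsTrunk.length_stem (he : A.IsTrunk e) {u : List Q} (hu : A.IsStem e u) :
    u.length = m + 1 := he.length_of_mem_bot _ hu

theorem length_of_mem_descendants (he : A.IsTrunk e) {f : A.Edge}
    (hf : Relation.ReflTransGen
      (fun g h : A.Edge => h.IsChild g ∧ h.Liftable (e (Fin.last m))) (e (Fin.last m)) f) :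
    f = e (Fin.last m) ∨
      f.Liftable (e (Fin.last m)) ∧ ∀ w, A.vertexOf w = f.bot → m + 1 < w.length := by
  induction hf with
  | refl => exact .inl rfl
  | @tail g h hg hgh ih =>
    refine .inr ⟨hgh.2, fun w hw => ?_⟩
    obtain ⟨p, x, hp, hx⟩ := h.adj
    have hw' := (vertexOf_eq_iff.1 (hw.trans hx.symm)).length_eq
    have hpb : A.vertexOf p = g.bot := hp.trans (show g.bot = h.top from hgh.1).symm
    have hpl : m + 1 ≤ p.length := by
      rcases ih with rfl | ih
      · exact (he.length_stem hpb).ge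
      · exact (ih.2 p hpb).le
    simp at hw'
    omega

/-- The suffix of trunk length of the path of an edge of the jungle tree is a stem. -/
theorem isStem_of_edgeOf_mem (he : A.IsTrunk e) {p v : List Q} {x : Q}
    (hf : A.edgeOf p x ∈ A.jungleTree e) (hv : v <:+ p ++ [x]) (hl : v.length = m + 1) :
    A.IsStem e v := by
  have hlift : (A.edgeOf p x).Liftable (e (Fin.last m)) → A.IsStem e v := by
    intro h
    obtain ⟨v', hv', hs⟩ := h (p ++ [x]) rfl
    have : v = v' := (List.suffix_of_suffix_length_le hv hs
      (by rw [hl, he.length_stem hv'])).eq_of_length (by rw [hl, he.length_stem hv'])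
    exact this ▸ hv'
  have hlast : A.edgeOf p x = e (Fin.last m) → A.IsStem e v := by
    intro h
    exact hlift (h ▸ fun w hw => ⟨w, hw, List.suffix_refl w⟩)
  rcases hf with ⟨i, hi⟩ | hf
  · have hpx := he.length_of_mem_bot i (u := p ++ [x]) (by rw [hi]; rfl)
    have := hv.length_le
    have hi' : i = Fin.last m := by
      apply Fin.ext
      have := i.2
      simp only [Fin.val_last]
      omega
    exact hlast (hi' ▸ hi.symm)
  · rcases length_of_mem_descendants he hf with h | h
    · exact hlast h
    · exact hlift h.1

/-- Suffixes of connected words are connected, so liftability need only be checked on one word of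
the component. -/
theorem liftable_of_isStem {a v : List Q} {f : A.Edge}
    (hf : f.bot = A.vertexOf (a ++ v)) (hv : A.IsStem e v) : f.Liftable (e (Fin.last m)) := by
  intro w hw
  have hc : A.Conn (a ++ v) w := vertexOf_eq_iff.1 (hf.symm.trans (Eq.symm hw))
  have := hc.drop a.length
  rw [List.drop_left] at this
  exact ⟨_, hv.of_conn this, List.drop_suffix _ _⟩

/-- The edges of the path of a prefix of a stem are those of the trunk. -/
theorem edgeOf_eq_of_mem_bot (i : Fin (m + 1)) {p : List Q} {x : Q}
    (h : A.vertexOf (p ++ [x]) = (e i).bot) : A.edgeOf p x = e i := by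
  obtain ⟨q, y, hq, hy⟩ := (e i).adj
  refine Edge.ext ?_ h
  rw [← hq]
  exact vertexOf_eq_iff.2 (vertexOf_eq_iff.1 (h.trans hy.symm)).of_concat

theorem IsTrunk.vertexOf_take (he : A.IsTrunk e) {u : List Q} (hu : A.IsStem e u)
    (i : Fin (m + 1)) : A.vertexOf (u.take (i + 1)) = (e i).bot := by
  induction i using Fin.reverseInduction with
  | last =>
    rw [List.take_of_length_le (by rw [he.length_stem hu]; simp)]
    exact hu
  | cast i ih =>
    have hlt : (i : ℕ) + 1 < u.length := by rw [he.length_stem hu]; have := i.2; omega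
    have hsplit : u.take (i + 1 + 1) = u.take (i + 1) ++ [u[(i : ℕ) + 1]] :=
      (List.take_concat_get' u _ hlt).symm
    rw [Fin.val_succ, hsplit] at ih
    have := congrArg Edge.top (edgeOf_eq_of_mem_bot i.succ ih)
    exact this.trans (he.path i).symm

/-- The words of the jungle tree that are at least as long as the trunk. -/
theorem isTreeWord_iff (he : A.IsTrunk e) {w : List Q} (hw : m + 1 ≤ w.length) :
    A.IsTreeWord (A.jungleTree e) w ↔ A.FactorStems e w := by
  constructor
  · refine fun h => ⟨hw, fun v hv hl => ?_⟩
    obtain ⟨a, b, rfl⟩ := hv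
    have hne : v ≠ [] := by rintro rfl; simp at hl
    have hsplit : a ++ v = (a ++ v.dropLast) ++ [v.getLast hne] := by
      rw [List.append_assoc, List.dropLast_append_getLast]
    refine isStem_of_edgeOf_mem he (p := a ++ v.dropLast) (x := v.getLast hne) (h _ _ ?_) ?_ hl
    · rw [← hsplit]; exact List.prefix_append _ _
    · rw [← hsplit]; exact List.suffix_append _ _
  · rintro ⟨-, h⟩
    have hstem : A.IsStem e (w.take (m + 1)) :=
      h _ (List.take_prefix _ _).isInfix (by simp [hw])
    have htrunk (p : List Q) (x : Q) (hp : p ++ [x] <+: w) (hl : p.length < m + 1) :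
        A.edgeOf p x = e ⟨p.length, hl⟩ := by
      apply edgeOf_eq_of_mem_bot
      rw [← he.vertexOf_take hstem, List.take_take]
      rw [List.prefix_iff_eq_take.1 hp]
      congr 2
      simp
      omega
    intro p
    induction p using List.reverseRecOn with
    | nil => exact fun x hp => .inl ⟨_, (htrunk _ _ hp (by simp)).symm⟩
    | append_singleton p y ih =>
      intro x hp
      by_cases hl : (p ++ [y]).length < m + 1
      · exact .inl ⟨_, (htrunk _ _ hp hl).symm⟩
      · have hp' : p ++ [y] <+: w := (List.prefix_append _ _).trans hp
        have hdesc : Relation.ReflTransGen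
            (fun g h : A.Edge => h.IsChild g ∧ h.Liftable (e (Fin.last m)))
            (e (Fin.last m)) (A.edgeOf p y) := by
          -- At this depth a trunk edge can only be the last one, which is the root of the
          -- descending tree.
          rcases ih y hp' with ⟨i, hi⟩ | hd
          · have hpx := he.length_of_mem_bot i (u := p ++ [y]) (by rw [hi]; rfl)
            have hi' : i = Fin.last m := by
              apply Fin.ext
              have := i.2
              simp only [Fin.val_last]
              omega
            rw [← hi, hi']
          · exact hd
        refine .inr (hdesc.tail ⟨rfl, ?_⟩)
        set q := p ++ [y] ++ [x] with hq
        have hql : m + 1 ≤ q.length := by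
          rw [hq, List.length_append]; omega
        refine liftable_of_isStem (a := q.take (q.length - (m + 1)))
          (v := q.drop (q.length - (m + 1))) ?_ (h _ ?_ ?_)
        · rw [List.take_append_drop]; rfl
        · exact (List.drop_suffix _ _).isInfix.trans hp.isInfix
        · rw [List.length_drop]; omega

theorem FactorStems.of_infix {v w : List Q} (h : A.FactorStems e w) (hv : v <:+: w)
    (hl : m + 1 ≤ v.length) : A.FactorStems e v :=
  ⟨hl, fun _ hu => h.2 _ (hu.trans hv)⟩

theorem FactorStems.isStem {w : List Q} (h : A.FactorStems e w) (hl : w.length = m + 1) :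
    A.IsStem e w := h.2 w (List.infix_refl w) hl

theorem IsTrunk.factorStems (he : A.IsTrunk e) {w : List Q} (h : A.IsStem e w) :
    A.FactorStems e w := by
  refine ⟨(he.length_stem h).ge, fun v hv hl => ?_⟩
  rwa [hv.eq_of_length (hl.trans (he.length_stem h).symm)]

/-- Two words that overlap in a stem can be glued. -/
theorem FactorStems.glue {a v b : List Q} (hl : m + 1 ≤ v.length) (h : A.FactorStems e (a ++ v))
    (h' : A.FactorStems e (v ++ b)) : A.FactorStems e (a ++ v ++ b) := by
  refine ⟨by simp; omega, ?_⟩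
  rintro u ⟨s, t, hst⟩ hu
  by_cases hs : s.length < a.length
  · refine h.2 u ?_ hu
    have : s ++ u <+: a ++ v := by
      refine List.prefix_of_prefix_length_le (l₃ := a ++ v ++ b) ⟨t, hst⟩
        (List.prefix_append _ _) ?_
      simp; omega
    exact (List.suffix_append s u).isInfix.trans this.isInfix
  · refine h'.2 u ?_ hu
    have : u ++ t <:+ v ++ b := by
      refine List.suffix_of_suffix_length_le (l₃ := a ++ v ++ b) ⟨s, by simpa using hst⟩
        ⟨a, by simp⟩ ?_
      have := congrArg List.length hst
      simp at this ⊢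
      omega
    exact (List.prefix_append u t).isInfix.trans this.isInfix

theorem FactorStems.of_conn {w w' : List Q} (h : A.FactorStems e w) (hc : A.Conn w w') :
    A.FactorStems e w' := by
  refine ⟨hc.length_eq ▸ h.1, ?_⟩
  rintro v ⟨a, b, rfl⟩ hv
  have h1 := (hc.drop a.length).take v.length
  rw [List.append_assoc, List.drop_left, List.take_left] at h1
  have hi : (w.drop a.length).take v.length <:+: w :=
    (List.take_prefix _ _).isInfix.trans (List.drop_suffix _ _).isInfix
  exact (h.2 _ hi (h1.length_eq.trans hv)).of_conn h1

/-! ### Rigidity from labels 1, and finite order -/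

/-- A one-letter extension of a stem within the jungle tree is determined by its component. -/
theorem IsTrunk.concat_unique [Finite Q] (he : A.IsTrunk e) (hrev : A.Reversible) {p : List Q}
    {x y : Q} (hp : A.IsStem e p) (h : A.FactorStems e (p ++ [x]))
    (hc : A.Conn (p ++ [x]) (p ++ [y])) : x = y := by
  refine concat_unique_of_label_eq_one hrev (he.label_children _ ⟨Eq.symm hp, ?_⟩) hc
  refine liftable_of_isStem (a := (p ++ [x]).take 1) (v := (p ++ [x]).drop 1) ?_
    (h.2 _ (List.drop_suffix _ _).isInfix ?_)
  · rw [List.take_append_drop]; rfl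
  · simp [he.length_stem hp]

/-- A long word of the jungle tree is determined, within its component, by its first stem. -/
theorem IsTrunk.eq_of_conn_of_take_eq [Finite Q] (he : A.IsTrunk e) (hrev : A.Reversible)
    {w w' : List Q} (h : A.FactorStems e w) (hc : A.Conn w w')
    (ht : w.take (m + 1) = w'.take (m + 1)) : w = w' := by
  induction w using List.reverseRecOn generalizing w' with
  | nil => exact absurd h.1 (by simp)
  | append_singleton w x ih =>
    have hl := hc.length_eq
    rcases List.eq_nil_or_concat' w' with rfl | ⟨w', y, rfl⟩
    · simp at hl
    simp at hl
    by_cases hw : m + 1 ≤ w.length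
    · have hww : w = w' := by
        refine ih (h.of_infix (List.prefix_append _ _).isInfix hw) hc.of_concat ?_
        rwa [List.take_append_of_le_length hw, List.take_append_of_le_length (hl ▸ hw)] at ht
      subst hww
      set k := w.length - (m + 1)
      have hk : k ≤ w.length := Nat.sub_le _ _
      have hdrop := hc.drop k
      rw [List.drop_append_of_le_length hk, List.drop_append_of_le_length hk] at hdrop
      have hlen : (w.drop k).length = m + 1 := by rw [List.length_drop]; omega
      have hf : A.FactorStems e (w.drop k ++ [x]) := by
        refine h.of_infix ?_ (by simp [hlen])
        rw [← List.drop_append_of_le_length hk]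
        exact (List.drop_suffix _ _).isInfix
      rw [he.concat_unique hrev
        ((hf.of_infix (List.prefix_append _ _).isInfix hlen.ge).isStem hlen) hf hdrop]
    · rwa [List.take_of_length_le (by simp; omega), List.take_of_length_le (by simp; omega)] at ht

/-- Powers of a word all of whose powers lie in the jungle tree have finite order. -/
theorem IsTrunk.exists_pow_actWord_eq [Finite Q] [Finite X] (he : A.IsTrunk e)
    (hinv : A.Invertible) (hrev : A.Reversible) {w : List Q}
    (hw : ∀ k : ℕ, A.FactorStems e (List.replicate (k + 1) w).flatten) :
    ∃ k : ℕ, ∀ t, A.actWord (List.replicate (k + 1) w).flatten t = t := by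
  have := finite_stem A e
  let W (k : ℕ) : List Q := (List.replicate (k + 1) w).flatten
  -- `S k` records the output function of the component of `W k`, each word being named by its first
  -- stem. It takes values in a finite type.
  let S (k : ℕ) : Set (A.Stem e × X × X) :=
    {q | ∃ v, A.Conn (W k) v ∧ v.take (m + 1) = q.1.1 ∧ A.outLetter v q.2.1 = q.2.2}
  obtain ⟨a, b, hab, hS⟩ := Finite.exists_ne_map_eq_of_infinite S
  wlog hlt : a < b generalizing a b
  · exact this b a hab.symm hS.symm (lt_of_le_of_ne (not_lt.1 hlt) hab.symm)
  have key (t : List X) : ∀ v v', A.Conn (W a) v → A.Conn (W b) v' →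
      v.take (m + 1) = v'.take (m + 1) → A.actWord v t = A.actWord v' t := by
    induction t with
    | nil => intros; rw [actWord_nil, actWord_nil]
    | cons i t ih =>
      intro v v' hv hv' ht
      have hF := (hw a).of_conn hv
      have hstem : A.IsStem e (v.take (m + 1)) :=
        hF.2 _ (List.take_prefix _ _).isInfix (by simp [hF.1])
      -- Equality of the tables provides a word of the other component with the same first stem and
      -- output; rigidity identifies it with `v'`.
      have hmem : ((⟨v.take (m + 1), hstem⟩, i, A.outLetter v i) : A.Stem e × X × X) ∈ S b := by
        rw [← hS]
        exact ⟨v, hv, rfl, rfl⟩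
      obtain ⟨v'', hv'', ht'', ho⟩ := hmem
      have : v'' = v' := he.eq_of_conn_of_take_eq hrev ((hw b).of_conn hv'')
        (hv''.symm.trans hv') (ht''.trans ht)
      subst this
      replace ho : A.outLetter v'' i = A.outLetter v i := ho
      rw [actWord_cons, actWord_cons, ho,
        ih _ _ (hv.trans (conn_act i v)) (hv'.trans (conn_act i v'')) (by
          rw [take_act, take_act, ht])]
  have htake (k : ℕ) : (W k).take (m + 1) = (W (k + 1)).take (m + 1) := by
    have : W (k + 1) = W k ++ w := by
      simp only [W, List.replicate_succ' (n := k + 1), List.flatten_append]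
      simp
    rw [this, List.take_append_of_le_length (hw k).1]
  have htake' (k : ℕ) : (W k).take (m + 1) = (W 0).take (m + 1) := by
    induction k with
    | zero => rfl
    | succ k ih => rw [← htake, ih]
  -- `W k` consists of `k + 1` copies of `w`, so `b - a` copies lead from `W a` to `W b`.
  refine ⟨b - a - 1, fun t => ?_⟩
  obtain ⟨s, rfl⟩ := hinv.actWord_surjective (W a) t
  rw [← actWord_append, ← List.flatten_append, ← List.replicate_add,
    show a + 1 + (b - a - 1 + 1) = b + 1 by omega]
  exact (key s _ _ (.refl _) (.refl _) (by rw [htake', htake' b])).symm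

/-! ### Reachability between stems, and closed paths -/

theorem IsTrunk.exists_concat (he : A.IsTrunk e) (hrev : A.Reversible) {u : List Q}
    (hu : A.IsStem e u) : ∃ x, A.FactorStems e (u ++ [x]) := by
  obtain ⟨f, hf, hlift⟩ := he.two_children.nonempty
  obtain ⟨p, x, hp, hx⟩ := f.adj
  have hp' : A.IsStem e p := hp.trans (Eq.symm hf)
  obtain ⟨y, hy⟩ := (hp'.conn hu).exists_concat hrev x
  obtain ⟨v, hv, hs⟩ := hlift (u ++ [y]) ((vertexOf_eq_iff.2 hy.symm).trans hx)
  have hul := he.length_stem hu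
  have hvl := he.length_stem hv
  refine ⟨y, by simp [hul], ?_⟩
  rintro w ⟨a, b, hab⟩ hw
  have hlen := congrArg List.length hab
  simp only [List.length_append, List.length_singleton] at hlen
  -- A word of length `m + 2` has two factors of length `m + 1`: here `u`, and the stem `v` given by
  -- liftability.
  by_cases ha : a = []
  · subst ha
    have : w = u := by
      have := congrArg (List.take (m + 1)) hab
      rwa [List.nil_append, List.take_left' hw, List.take_left' hul] at this
    exact this ▸ hu
  · have hb : b = [] := by
      have := List.length_pos_iff.2 ha
      exact List.length_eq_zero_iff.1 (by omega)
    subst hb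
    have : w = v := (List.suffix_of_suffix_length_le (l₃ := u ++ [y]) ⟨a, by simpa using hab⟩ hs
      (by omega)).eq_of_length (by omega)
    exact this ▸ hv

/-- The stem `v` can be reached from the word `u`: it ends an extension of `u` in the jungle
tree. -/
def Reaches (A : MealyAut Q X) {m : ℕ} (e : Fin (m + 1) → A.Edge) (u v : List Q) : Prop :=
  ∃ r, A.FactorStems e (u ++ r) ∧ v <:+ u ++ r

theorem Reaches.trans {u v w : List Q} (hv : m + 1 ≤ v.length) (h : A.Reaches e u v)
    (h' : A.Reaches e v w) : A.Reaches e u w := by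
  obtain ⟨r, hr, p, hp⟩ := h
  obtain ⟨r', hr', hw⟩ := h'
  have hglue : u ++ (r ++ r') = p ++ v ++ r' := by rw [hp, List.append_assoc]
  refine ⟨r ++ r', hglue ▸ FactorStems.glue hv (hp ▸ hr) hr', ?_⟩
  rw [hglue, List.append_assoc]
  exact hw.trans (List.suffix_append _ _)

/-- The extensions of stems within one component permute the stems, so that each of them can be
undone by iteration. -/
theorem IsTrunk.reaches_of_concat [Finite Q] (he : A.IsTrunk e) (hb : A.Bireversible)
    {u : List Q} {x : Q} (hu : A.IsStem e u) (h : A.FactorStems e (u ++ [x])) :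
    A.Reaches e ((u ++ [x]).drop 1) u := by
  have := finite_stem A e
  have hex (v : A.Stem e) : ∃ y, A.Conn (u ++ [x]) (v.1 ++ [y]) :=
    (hu.conn v.2).exists_concat hb.2.1 x
  choose g hg using hex
  have hF (v : A.Stem e) : A.FactorStems e (v.1 ++ [g v]) := h.of_conn (hg v)
  have hT (v : A.Stem e) : A.IsStem e ((v.1 ++ [g v]).drop 1) :=
    (hF v).2 _ (List.drop_suffix _ _).isInfix (by simp [he.length_stem v.2])
  let T (v : A.Stem e) : A.Stem e := ⟨_, hT v⟩
  have huniq (v : A.Stem e) (y : Q) (hy : A.Conn (u ++ [x]) (v.1 ++ [y])) : g v = y :=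
    he.concat_unique hb.2.1 v.2 (hF v) ((hg v).symm.trans hy)
  have hTu : (T ⟨u, hu⟩).1 = (u ++ [x]).drop 1 := by
    change (u ++ [g ⟨u, hu⟩]).drop 1 = _
    rw [huniq ⟨u, hu⟩ x (.refl _)]
  -- A preimage of `v` comes from prepending a letter: some `z v` is connected to `u x`, and its
  -- first `m + 1` letters form a stem that `T` sends to `v`.
  have hsurj : Function.Surjective T := by
    intro v
    have hne : u ++ [x] ≠ [] := by simp
    have hcons : (u ++ [x]).head hne :: (u ++ [x]).drop 1 = u ++ [x] := by
      rw [List.drop_one]; exact List.cons_head_tail hne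
    have hc : A.Conn ((u ++ [x]).drop 1) v.1 := hTu ▸ IsStem.conn (T ⟨u, hu⟩).2 v.2
    obtain ⟨z, hz⟩ := hc.exists_cons hb ((u ++ [x]).head hne)
    rw [hcons] at hz
    have hlast : (z :: v.1).dropLast ++ [(z :: v.1).getLast (by simp)] = z :: v.1 :=
      List.dropLast_append_getLast _
    rw [← hlast] at hz
    have hstem : A.IsStem e (z :: v.1).dropLast := hu.of_conn hz.of_concat
    refine ⟨⟨_, hstem⟩, Subtype.ext ?_⟩
    change ((z :: v.1).dropLast ++ [g ⟨_, hstem⟩]).drop 1 = v.1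
    rw [huniq ⟨_, hstem⟩ _ hz, hlast]
    rfl
  have hiter (k : ℕ) (v : A.Stem e) : A.Reaches e v.1 (T^[k] v).1 := by
    induction k generalizing v with
    | zero => exact ⟨[], by simpa using he.factorStems v.2, by simp⟩
    | succ k ih =>
      exact Reaches.trans (he.length_stem (T v).2).ge
        ⟨[g v], hF v, List.drop_suffix _ _⟩ (ih (T v))
  -- A surjection of a finite set is a permutation, so `u` is periodic and the remaining `k - 1`
  -- steps lead from `T u` back to `u`.
  obtain ⟨k, hk, hper⟩ :=
    (Finite.injective_iff_surjective.2 hsurj).mem_periodicPts (⟨u, hu⟩ : A.Stem e)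
  have := hiter (k - 1) (T ⟨u, hu⟩)
  rwa [← Function.iterate_succ_apply, Nat.succ_eq_add_one, Nat.sub_add_cancel hk, hper.eq, hTu]
    at this

/-- The path is undone one letter at a time, starting with its last letter. -/
theorem IsTrunk.reaches_symm [Finite Q] (he : A.IsTrunk e) (hb : A.Bireversible) {u v : List Q}
    (hu : A.IsStem e u) (hv : A.IsStem e v) (h : A.Reaches e u v) : A.Reaches e v u := by
  obtain ⟨r, hr, hvr⟩ := h
  induction r using List.reverseRecOn generalizing v with
  | nil =>
    rw [List.append_nil] at hvr
    rw [hvr.eq_of_length (by rw [he.length_stem hu, he.length_stem hv])]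
    exact ⟨[], by simpa using he.factorStems hu, by simp⟩
  | append_singleton r x ih =>
    have hul := he.length_stem hu
    have hvl := he.length_stem hv
    rw [← List.append_assoc] at hr hvr
    set k := (u ++ r).length - (m + 1)
    have hk : k ≤ (u ++ r).length := Nat.sub_le _ _
    have hlen : ((u ++ r).drop k).length = m + 1 := by
      simp only [List.length_drop, List.length_append, k]; omega
    have hF : A.FactorStems e ((u ++ r).drop k ++ [x]) := by
      rw [← List.drop_append_of_le_length hk]
      refine hr.of_infix (List.drop_suffix _ _).isInfix ?_
      rw [List.drop_append_of_le_length hk, List.length_append]; omega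
    have hs : A.IsStem e ((u ++ r).drop k) := hF.2 _ (List.prefix_append _ _).isInfix hlen
    have hveq : v = ((u ++ r).drop k ++ [x]).drop 1 := by
      have h1 : ((u ++ r).drop k ++ [x]).drop 1 <:+ u ++ r ++ [x] := by
        rw [← List.drop_append_of_le_length hk]
        exact (List.drop_suffix _ _).trans (List.drop_suffix _ _)
      have h2 : (((u ++ r).drop k ++ [x]).drop 1).length = m + 1 := by
        rw [List.length_drop, List.length_append, hlen]; simp
      exact (List.suffix_of_suffix_length_le hvr h1 (by omega)).eq_of_length (by omega)
    rw [hveq]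
    refine Reaches.trans hlen.ge (he.reaches_of_concat hb hs hF) (ih hs ?_ (List.drop_suffix _ _))
    exact hr.of_infix (List.prefix_append _ _).isInfix (by rw [List.length_append]; omega)

theorem IsTrunk.exists_append_stem (he : A.IsTrunk e) (hrev : A.Reversible) {u : List Q}
    (hu : A.IsStem e u) (k : ℕ) : ∃ r, r.length = k ∧ A.FactorStems e (u ++ r) := by
  induction k with
  | zero => exact ⟨[], rfl, by simpa using he.factorStems hu⟩
  | succ k ih =>
    obtain ⟨r, hr, hF⟩ := ih
    set j := (u ++ r).length - (m + 1)
    have hlen : ((u ++ r).drop j).length = m + 1 := by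
      have := hF.1
      rw [List.length_drop]; omega
    obtain ⟨x, hx⟩ := he.exists_concat hrev (hF.2 _ (List.drop_suffix j _).isInfix hlen)
    refine ⟨r ++ [x], by simp [hr], ?_⟩
    rw [← List.append_assoc, ← List.take_append_drop j (u ++ r)]
    exact FactorStems.glue hlen.ge (by rwa [List.take_append_drop]) hx

/-- Every path in the jungle tree between stems can be continued back to its origin. -/
theorem IsTrunk.exists_return [Finite Q] (he : A.IsTrunk e) (hb : A.Bireversible)
    {u v : List Q} (hu : A.IsStem e u) (hv : A.IsStem e v) (h : A.Reaches e u v) :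
    ∃ t, A.FactorStems e (v ++ t ++ u) := by
  obtain ⟨r, hr, p, hp⟩ := he.reaches_symm hb hu hv h
  -- The path from `v` to `u` may end in an occurrence of `u` that overlaps `v`. A detour from `u`
  -- through a further stem `s` and back gives an occurrence disjoint from `v`.
  obtain ⟨s, hs, hus⟩ := he.exists_append_stem hb.2.1 hu (m + 1)
  have hss : A.IsStem e s := hus.2 _ (List.suffix_append _ _).isInfix hs
  obtain ⟨r', hr', q, hq⟩ := he.reaches_symm hb hu hss ⟨s, hus, List.suffix_append _ _⟩
  have hul := he.length_stem hu
  have h1 : A.FactorStems e (p ++ u ++ s) := FactorStems.glue hul.ge (hp ▸ hr) hus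
  have h2 : A.FactorStems e (p ++ u ++ s ++ r') := FactorStems.glue hs.ge h1 hr'
  refine ⟨r ++ q, ?_⟩
  have : v ++ (r ++ q) ++ u = p ++ u ++ s ++ r' := by
    rw [hp, List.append_assoc _ s r', ← hq]
    simp only [List.append_assoc]
  rwa [this]

/-- A closed path in the jungle tree can be repeated until it acts trivially. -/
theorem IsTrunk.exists_trivial_cycle [Finite Q] [Finite X] (he : A.IsTrunk e)
    (hb : A.Bireversible) {u s : List Q} (hu : A.IsStem e u)
    (h : A.FactorStems e (u ++ s ++ u)) :
    ∃ r, A.FactorStems e (u ++ s ++ r ++ u) ∧ ∀ t, A.actWord (u ++ s ++ r) t = t := by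
  have hul := he.length_stem hu
  have hpow (k : ℕ) : A.FactorStems e ((List.replicate k (u ++ s)).flatten ++ u) := by
    induction k with
    | zero => simpa using he.factorStems hu
    | succ k ih =>
      have := FactorStems.glue (b := s ++ u) hul.ge ih (by simpa using h)
      rw [List.replicate_succ', List.flatten_append]
      simpa using this
  have hsplit (k : ℕ) : (List.replicate (k + 1) (u ++ s)).flatten =
      u ++ s ++ (List.replicate k (u ++ s)).flatten := by
    rw [List.replicate_succ, List.flatten_cons]
  obtain ⟨k, hk⟩ := he.exists_pow_actWord_eq hb.1 hb.2.1 (w := u ++ s) fun k =>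
    (hpow (k + 1)).of_infix (List.prefix_append _ _).isInfix (by
      rw [hsplit]; simp only [List.length_append]; omega)
  exact ⟨_, hsplit k ▸ hpow (k + 1), hsplit k ▸ hk⟩

/-! ### The relations `∼` and `∧` -/

theorem stemEquiv_iff (he : A.IsTrunk e) {u v : A.Stem e} : A.StemEquiv e u v ↔
    ∃ s, A.FactorStems e (u.1 ++ s ++ v.1) ∧ ∀ t, A.actWord (u.1 ++ s) t = t := by
  have := he.length_stem u.2
  exact exists_congr fun s => and_congr_left fun _ =>
    isTreeWord_iff he (by simp only [List.length_append]; omega)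

theorem sibling_iff (he : A.IsTrunk e) {u v : A.Stem e} : A.Sibling e u v ↔
    ∃ s : A.Stem e, A.FactorStems e (s.1 ++ u.1) ∧ A.FactorStems e (s.1 ++ v.1) := by
  refine exists_congr fun s => ?_
  have := he.length_stem s.2
  exact and_congr (isTreeWord_iff he (by simp only [List.length_append]; omega))
    (isTreeWord_iff he (by simp only [List.length_append]; omega))

theorem IsTrunk.exists_loop [Finite Q] (he : A.IsTrunk e) (hb : A.Bireversible) {u : List Q}
    (hu : A.IsStem e u) : ∃ t, A.FactorStems e (u ++ t ++ u) :=
  he.exists_return hb hu hu ⟨[], by simpa using he.factorStems hu, by simp⟩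

theorem IsTrunk.stemEquiv_equivalence [Finite Q] [Finite X] (he : A.IsTrunk e)
    (hb : A.Bireversible) : Equivalence (A.StemEquiv e) where
  refl u := by
    obtain ⟨s, hs⟩ := he.exists_loop hb u.2
    obtain ⟨r, hr, hid⟩ := he.exists_trivial_cycle hb u.2 hs
    exact (stemEquiv_iff he).2 ⟨s ++ r, by simpa using hr, by simpa using hid⟩
  symm {u v} h := by
    obtain ⟨s, hs, hid⟩ := (stemEquiv_iff he).1 h
    have hul := he.length_stem u.2
    have hvl := he.length_stem v.2
    obtain ⟨t, ht⟩ := he.exists_return hb u.2 v.2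
      ⟨s ++ v.1, by simpa using hs, by rw [← List.append_assoc]; exact List.suffix_append _ _⟩
    have hcyc : A.FactorStems e (u.1 ++ (s ++ v.1 ++ t) ++ u.1) := by
      simpa using FactorStems.glue (b := t ++ u.1) hvl.ge hs (by simpa using ht)
    obtain ⟨r, hr, hid'⟩ := he.exists_trivial_cycle hb u.2 hcyc
    refine (stemEquiv_iff he).2 ⟨t ++ r, ?_, fun z => ?_⟩
    · refine hr.of_infix (List.IsSuffix.isInfix ⟨u.1 ++ s, by simp⟩) ?_
      simp only [List.length_append]; omega
    -- The cycle `u s v t r` and its prefix `u s` both act trivially, hence so does `v t r`.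
    · have := hid' z
      rwa [show u.1 ++ (s ++ v.1 ++ t) ++ r = (u.1 ++ s) ++ (v.1 ++ (t ++ r)) by simp,
        actWord_append, hid] at this
  trans {u v w} h h' := by
    obtain ⟨s, hs, hid⟩ := (stemEquiv_iff he).1 h
    obtain ⟨t, ht, hid'⟩ := (stemEquiv_iff he).1 h'
    refine (stemEquiv_iff he).2 ⟨s ++ v.1 ++ t, ?_, fun z => ?_⟩
    · simpa using FactorStems.glue (b := t ++ w.1) (he.length_stem v.2).ge hs (by simpa using ht)
    · rw [show u.1 ++ (s ++ v.1 ++ t) = (u.1 ++ s) ++ (v.1 ++ t) by simp, actWord_append, hid, hid']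

/-- In a loop `u t u`, the `m + 1` letters before the final `u` form a stem that can precede `u`. -/
theorem IsTrunk.sibling_refl [Finite Q] (he : A.IsTrunk e) (hb : A.Bireversible)
    (u : A.Stem e) : A.Sibling e u u := by
  obtain ⟨t, ht⟩ := he.exists_loop hb u.2
  have hul := he.length_stem u.2
  have hlen : ((u.1 ++ t).drop t.length).length = m + 1 := by simp [hul]
  have hinf : (u.1 ++ t).drop t.length ++ u.1 <:+: u.1 ++ t ++ u.1 :=
    List.IsSuffix.isInfix ⟨(u.1 ++ t).take t.length, by
      rw [← List.append_assoc, List.take_append_drop]⟩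
  have hF := ht.of_infix hinf (by rw [List.length_append]; omega)
  exact (sibling_iff he).2 ⟨⟨_, hF.2 _ (List.prefix_append _ _).isInfix hlen⟩, hF, hF⟩

theorem IsTrunk.wedge_equivalence [Finite Q] (he : A.IsTrunk e) (hb : A.Bireversible) :
    Equivalence (A.Wedge e) where
  refl u := .single (he.sibling_refl hb u)
  symm h := by
    have hsymm : ∀ u v, A.Sibling e u v → A.Sibling e v u := fun _ _ ⟨s, h, h'⟩ => ⟨s, h', h⟩
    induction h with
    | single h => exact .single (hsymm _ _ h)
    | tail _ h ih => exact .head (hsymm _ _ h) ih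
  trans h h' := Relation.TransGen.trans h h'

theorem IsTrunk.stemEquiv_of_sibling [Finite Q] [Finite X] (he : A.IsTrunk e)
    (hb : A.Bireversible) {u v : A.Stem e} (h : A.Sibling e u v) : A.StemEquiv e u v := by
  obtain ⟨s, hu, hv⟩ := (sibling_iff he).1 h
  have hul := he.length_stem u.2
  have hsl := he.length_stem s.2
  obtain ⟨t, ht⟩ := he.exists_return hb s.2 u.2 ⟨u.1, hu, List.suffix_append _ _⟩
  have hcyc : A.FactorStems e (s.1 ++ (u.1 ++ t) ++ s.1) := by
    simpa using FactorStems.glue (b := t ++ s.1) hul.ge hu (by simpa using ht)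
  obtain ⟨r, hr, hid⟩ := he.exists_trivial_cycle hb s.2 hcyc
  -- The trivial cycle `s u t r` returns to `s`, where `v` may follow; its rotation `u t r s` is the
  -- trivial prefix required.
  refine (stemEquiv_iff he).2 ⟨t ++ r ++ s.1, ?_, ?_⟩
  · refine (FactorStems.glue hsl.ge hr hv).of_infix (List.IsSuffix.isInfix ⟨s.1, by simp⟩) ?_
    simp only [List.length_append]; omega
  · have := hb.1.actWord_rotate (u := s.1) (v := u.1 ++ (t ++ r)) (by simpa using hid)
    simpa using this

end Trunk

end MealyAut

theorem mainTheorem7 {Q X : Type*} [Finite Q] [Finite X] (A : MealyAut Q X)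
    (hconn : A.Connected) (hbirev : A.Bireversible) (hbranch : A.NoActiveSelfLiftableBranch)
    {m : ℕ} (e : Fin (m + 1) → A.Edge) (he : A.IsTrunk e) :
    Equivalence (A.StemEquiv e) ∧
      Equivalence (A.Wedge e) ∧
      ∀ u v : A.Stem e, A.Wedge e u v → A.StemEquiv e u v := by
  have hequiv := he.stemEquiv_equivalence hbirev
  refine ⟨hequiv, he.wedge_equivalence hbirev, fun u v h => ?_⟩
  induction h with
  | single h => exact he.stemEquiv_of_sibling hbirev h
  | tail _ h ih => exact hequiv.trans ih (he.stemEquiv_of_sibling hbirev h)
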